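/- Let $J\subseteq\mathbb R$ be a nondegenerate interval (bounded or unbounded). In what follows, a subinterval of $J$ means a bounded nondegenerate interval $I\subseteq J$, and $|I|$ is its length. For a measurable function $\varphi:J\to[0,\infty)$, the $A_1$-constant $[\varphi]_1$ of $\varphi$ on $J$ is the least $C\ge 1$ such that $$\frac1{|I|}\int_I\varphi\,dx\le C\,\operatorname*{ess\,inf}_I\varphi\qquad\text{for every subinterval } I \text{ of } J .$$ Let $c\ge1$ and $1\le p<\frac{c}{c-1}$ (where $\frac{c}{c-1}=\infty$ if $c=1$). (a) If $\varphi:J\to[0,\infty)$ is measurable and satisfies the displayed condition with $C=c$ (in particular, if $[\varphi]_1=c$), then $\varphi\in L^p(I)$ for every subinterval $I$ of $J$ (so $\varphi\in L^p(J)$ when $J$ is bounded), and $$\frac1{|I|}\int_I\varphi^p\,dx\le\frac1{c^{p-1}(c+p-pc)}\Bigl(\frac1{|I|}\int_I\varphi\,dx\Bigr)^p\qquad\text{for every subinterval } I \text{ of } J .$$ (b) The constant is sharp: if $J\ne\mathbb R$, then for every real $K<\frac1{c^{p-1}(c+p-pc)}$ there are a measurable $\varphi:J\to(0,\infty)$ with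 $[\varphi]_1=c$ on $J$ and a subinterval $I$ of $J$ with $$\frac1{|I|}\int_I\varphi^p\,dx>K\Bigl(\frac1{|I|}\int_I\varphi\,dx\Bigr)^p .$$ -/

import Mathlib

open MeasureTheory

/-- A nondegenerate interval of the real line (bounded or not, with or without endpoints). -/
def IsInterval (J : Set ℝ) : Prop :=
  J.OrdConnected ∧ J.Nontrivial

/-- `I` is a bounded nondegenerate subinterval of `J`, so that `0 < |I| < ∞`. -/
def IsSubinterval (I J : Set ℝ) : Prop :=
  IsInterval I ∧ Bornology.IsBounded I ∧ I ⊆ J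

/-- `φ` is a nonnegative measurable function on `J` with
`(1/|I|) ∫_I φ ≤ c * essinf_I φ` for every bounded nondegenerate subinterval `I` of `J`,
where `c ≥ 1`. Both sides are taken in `[0,∞]`, so no integrability is presupposed. -/
structure IsA1Weight (φ : ℝ → ℝ) (J : Set ℝ) (c : ℝ) : Prop where
  one_le : 1 ≤ c
  nonneg : ∀ x ∈ J, 0 ≤ φ x
  aemeasurable : AEMeasurable φ (volume.restrict J)
  average_le : ∀ I : Set ℝ, IsSubinterval I J →
    ⨍⁻ x in I, ENNReal.ofReal (φ x) ∂volume ≤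
      ENNReal.ofReal c * essInf (fun x => ENNReal.ofReal (φ x)) (volume.restrict I)

/-- `c` is the `A₁`-constant of `φ` on `J`, the least constant in the `A₁` condition. -/
def HasA1Constant (φ : ℝ → ℝ) (J : Set ℝ) (c : ℝ) : Prop :=
  IsLeast {C : ℝ | IsA1Weight φ J C} c

/-! For (a), let `m` be the mean of `φ` over an interval and put `l = m / c`, so that `φ ≥ l` almost
everywhere there. For `t ≥ l`, the rising sun lemma applied to `φ - c * t` gives an open set `G`
covered by intervals on which the mean of `φ` is exactly `c * t`. The `A₁` condition on these
intervals forces `φ ≥ t` a.e. on `G`, while `φ ≤ c * t` a.e. off `G` and the integral of `φ` over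
`G` is at most `c * t * |G|`. Hence the integral of `φ` over `{t ≤ φ}` is at most `c * t * |{t ≤
φ}|` (`setIntegral_superlevel_le_of_A1`).

Integrating this against `t ^ (p - 2)` over `t > l` and reading both sides by the layer cake formula
gives a linear inequality for the integral of `φ ^ p`. Its coefficient `c + p - p * c` is positive
exactly in the stated range of `p` (`lintegral_rpow_le_of_superlevel_bound`).

For (b), a proper interval has a finite endpoint `a`, and `|x - a| ^ (1 / c - 1)` has constant `c`
and attains equality on intervals ending at `a`. -/

open Set Filter Topology

/-! ### Rising sun lemma -/

/-- **Rising sun lemma** for an integral which never exceeds its initial value: there is an open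
set `G`, covered by intervals of vanishing integral, outside of which the integrand is nonpositive,
and over which its integral is nonpositive. -/
theorem exists_isOpen_risingSun_of_forall_integral_nonpos {f : ℝ → ℝ} {a b : ℝ} (hab : a ≤ b)
    (hf : IntervalIntegrable f volume a b) (h0 : ∀ y ∈ Icc a b, ∫ x in a..y, f x ≤ 0) :
    ∃ G : Set ℝ, IsOpen G ∧ G ⊆ Ioo a b ∧
      (∀ x ∈ G, ∃ z y, a ≤ z ∧ z < x ∧ x < y ∧ y ≤ b ∧ ∫ t in z..y, f t = 0) ∧
      (∀ᵐ x, x ∈ Ioo a b → x ∉ G → f x ≤ 0) ∧ ∫ x in G, f x ≤ 0 := by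
  set F : ℝ → ℝ := fun y => ∫ x in a..y, f x with hF
  have hFa : F a = 0 := by simp [hF]
  have hFc : ContinuousOn F (Icc a b) := by
    have := intervalIntegral.continuousOn_primitive_interval (μ := volume) (f := f) (a := a) (b := b)
      (by rw [uIcc_of_le hab]; exact (intervalIntegrable_iff_integrableOn_Icc_of_le hab).1 hf)
    rwa [uIcc_of_le hab] at this
  have hint : ∀ {u v}, u ∈ Icc a b → v ∈ Icc a b → IntervalIntegrable f volume u v := by
    intro u v hu hv
    refine hf.mono_set ?_
    rw [uIcc_of_le hab]
    exact uIcc_subset_Icc hu hv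
  set G : Set ℝ := ⋃ y ∈ Icc a b, (Ioo a y ∩ F ⁻¹' Iio (F y)) with hG
  have hGmem : ∀ x, x ∈ G ↔ ∃ y ∈ Icc a b, x ∈ Ioo a y ∧ F x < F y := by
    intro x; simp [hG]; grind
  have hGo : IsOpen G := isOpen_biUnion fun y hy =>
    (hFc.mono (Ioo_subset_Icc_self.trans (Icc_subset_Icc_right hy.2))).isOpen_inter_preimage
      isOpen_Ioo isOpen_Iio
  have hGs : G ⊆ Ioo a b := by
    intro x hx
    obtain ⟨y, hy, hxy, -⟩ := (hGmem x).1 hx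
    exact ⟨hxy.1, hxy.2.trans_le hy.2⟩
  have hMex : ∀ x ∈ Icc a b, ∃ m, (∃ y ∈ Icc x b, F y = m) ∧ ∀ y ∈ Icc x b, F y ≤ m := by
    intro x hx
    obtain ⟨y, hy, hmax⟩ := isCompact_Icc.exists_isMaxOn (nonempty_Icc.2 hx.2)
      (hFc.mono (Icc_subset_Icc_left hx.1))
    exact ⟨F y, ⟨y, hy, rfl⟩, fun z hz => hmax hz⟩
  -- `M x` is the maximum of `F` over `[x, b]`. It is antitone, so `-M` is differentiable a.e.; `G`
  -- is where `F < M` inside `(a, b)`.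
  choose! M hM1 hM2 using hMex
  have hMono : MonotoneOn (fun x => -M x) (Icc a b) := by
    intro x hx x' hx' hxx'
    obtain ⟨y, hy, hyM⟩ := hM1 x' hx'
    have := hM2 x hx y ⟨hxx'.trans hy.1, hy.2⟩
    simp only [neg_le_neg_iff]; linarith
  have hae : ∀ᵐ x, x ∈ Ioo a b →
      (x ∉ G → f x ≤ 0) ∧ deriv (fun x => -M x) x = Gᶜ.indicator (fun x => -f x) x := by
    filter_upwards [hf.ae_hasDerivAt_integral, hMono.ae_differentiableWithinAt_of_mem]
      with x hx1 hx2 hx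
    have hxI := Ioo_subset_Icc_self hx
    have hFd : HasDerivAt F (f x) x := hx1 (by rwa [uIcc_of_le hab]) a (by simp)
    have hMd : DifferentiableAt ℝ (fun x => -M x) x :=
      (hx2 hxI).differentiableAt (Icc_mem_nhds hx.1 hx.2)
    by_cases hxG : x ∈ G
    · refine ⟨fun h => absurd hxG h, ?_⟩
      rw [indicator_of_notMem (by simpa using hxG)]
      obtain ⟨y, hy, hyM⟩ := hM1 x hxI
      obtain ⟨y', hy', hxy', hlt⟩ := (hGmem x).1 hxG
      have hxM : F x < M x := hlt.trans_le (hM2 x hxI y' ⟨hxy'.2.le, hy'.2⟩)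
      have hxy : x < y := lt_of_le_of_ne hy.1 (by rintro rfl; linarith)
      -- The maximum over `[x, b]` is attained at `y > x`, so `M` is constant on `[x, y)`. This
      -- right-sided information determines the derivative, which is known to exist.
      have hconst : ∀ x' ∈ Ico x y, -M x' = -M x := by
        intro x' hx'
        have hx'I : x' ∈ Icc a b := ⟨hxI.1.trans hx'.1, hx'.2.le.trans hy.2⟩
        have h1 := hM2 x' hx'I y ⟨hx'.2.le, hy.2⟩
        have h2 := hMono hxI hx'I hx'.1
        simp only [neg_le_neg_iff] at h2
        linarith
      have hd0 : HasDerivWithinAt (fun x => -M x) 0 (Ico x y) x :=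
        (hasDerivWithinAt_const x (Ico x y) (-M x)).congr hconst rfl
      exact (uniqueDiffOn_Ico x y x ⟨le_rfl, hxy⟩).eq_deriv _ hMd.hasDerivAt.hasDerivWithinAt hd0
    · have hFM : M x = F x := by
        obtain ⟨y, hy, hyM⟩ := hM1 x hxI
        refine le_antisymm ?_ (hM2 x hxI x ⟨le_rfl, hxI.2⟩)
        rcases hy.1.eq_or_lt with rfl | hlt
        · exact hyM.ge
        · by_contra! hc
          exact hxG ((hGmem x).2 ⟨y, ⟨hxI.1.trans hy.1, hy.2⟩, ⟨hx.1, hlt⟩, by rwa [hyM]⟩)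
      -- Off `G`, `F` touches `M` from below at `x`, so the derivatives agree and `f x = M' x ≤ 0`.
      have hmax : IsLocalMax (fun t => -M t + F t) x := by
        filter_upwards [Icc_mem_nhds hx.1 hx.2] with t ht
        have := hM2 t ht t ⟨le_rfl, ht.2⟩
        simp only [hFM]; linarith
      have hd := hmax.hasDerivAt_eq_zero (hMd.hasDerivAt.add hFd)
      have hnn : 0 ≤ deriv (fun x => -M x) x := by
        rw [← derivWithin_of_mem_nhds (Icc_mem_nhds hx.1 hx.2)]
        exact hMono.derivWithin_nonneg
      refine ⟨fun _ => by linarith, ?_⟩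
      rw [indicator_of_mem (by simpa using hxG)]
      linarith
  refine ⟨G, hGo, hGs, ?_, ?_, ?_⟩
  · intro x hx
    obtain ⟨y, hy, hxy, hlt⟩ := (hGmem x).1 hx
    have hxI := Ioo_subset_Icc_self (hGs hx)
    have hFy : F y ≤ F a := by rw [hFa]; exact h0 y hy
    -- Since `F x < F y ≤ F a`, the value `F y` is already taken to the left of `x`.
    obtain ⟨z, hz, hzy⟩ := intermediate_value_Icc' hxI.1 (hFc.mono (Icc_subset_Icc_right hxI.2))
      (show F y ∈ Icc (F x) (F a) from ⟨hlt.le, hFy⟩)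
    have hzI : z ∈ Icc a b := ⟨hz.1, hz.2.trans hxI.2⟩
    refine ⟨z, y, hz.1, lt_of_le_of_ne hz.2 ?_, hxy.2, hy.2, ?_⟩
    · rintro rfl; linarith
    · have := intervalIntegral.integral_interval_sub_left (hint ⟨le_rfl, hab⟩ hy)
        (hint ⟨le_rfl, hab⟩ hzI)
      rw [← this]; simpa [hF] using sub_eq_zero.2 hzy.symm
  · filter_upwards [hae] with x hx h1 using (hx h1).1
  · have hI : IntegrableOn f (Ioo a b) := (intervalIntegrable_iff_integrableOn_Ioo_of_le hab).1 hf
    -- For a monotone function the integral of the derivative is at most the increment. This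
    -- inequality suffices: it yields `∫_G f ≤ M a ≤ 0` with neither absolute continuity of `M` nor
    -- a decomposition of `G` into components.
    have h1 := MonotoneOn.intervalIntegral_deriv_mem_uIcc (by rwa [uIcc_of_le hab])
    have haI : a ∈ Icc a b := ⟨le_rfl, hab⟩
    have hbI : b ∈ Icc a b := ⟨hab, le_rfl⟩
    have h01 := hMono haI hbI hab
    simp only at h01
    rw [uIcc_of_le (by linarith)] at h1
    have h2 : ∫ x in a..b, deriv (fun x => -M x) x = -∫ x in Ioo a b \ G, f x := by
      rw [intervalIntegral.integral_of_le hab, integral_Ioc_eq_integral_Ioo,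
        ← integral_neg, sdiff_eq, ← setIntegral_indicator hGo.measurableSet.compl]
      refine setIntegral_congr_ae measurableSet_Ioo ?_
      filter_upwards [hae] with x hx h1 using (hx h1).2
    have h3 := integral_inter_add_sdiff hGo.measurableSet hI
    rw [inter_eq_right.2 hGs] at h3
    have h4 : F b = ∫ x in Ioo a b, f x := by
      simp only [hF]; rw [intervalIntegral.integral_of_le hab, integral_Ioc_eq_integral_Ioo]
    obtain ⟨y, hy, hyM⟩ := hM1 a haI
    have h5 := h0 y hy
    have h6 := hM2 b hbI b ⟨le_rfl, le_rfl⟩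
    obtain ⟨y', hy', hyM'⟩ := hM1 b hbI
    have : y' = b := le_antisymm hy'.2 hy'.1
    subst this
    have h7 := h1.2
    change F y ≤ 0 at h5
    linarith

/-- **Rising sun lemma** for an integrand of nonpositive integral: there is an open
set `G`, covered by intervals of vanishing integral, outside of which the integrand is nonpositive,
and over which its integral is nonpositive. -/
theorem exists_isOpen_risingSun {f : ℝ → ℝ} {a b : ℝ} (hab : a ≤ b)
    (hf : IntervalIntegrable f volume a b) (h0 : ∫ x in a..b, f x ≤ 0) :
    ∃ G : Set ℝ, IsOpen G ∧ G ⊆ Ioo a b ∧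
      (∀ x ∈ G, ∃ z y, a ≤ z ∧ z < x ∧ x < y ∧ y ≤ b ∧ ∫ t in z..y, f t = 0) ∧
      (∀ᵐ x, x ∈ Ioo a b → x ∉ G → f x ≤ 0) ∧ ∫ x in G, f x ≤ 0 := by
  set F : ℝ → ℝ := fun y => ∫ x in a..y, f x with hF
  have hFa : F a = 0 := by simp [hF]
  have hFc : ContinuousOn F (Icc a b) := by
    have := intervalIntegral.continuousOn_primitive_interval (μ := volume) (f := f) (a := a) (b := b)
      (by rw [uIcc_of_le hab]; exact (intervalIntegrable_iff_integrableOn_Icc_of_le hab).1 hf)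
    rwa [uIcc_of_le hab] at this
  have hint : ∀ {u v}, u ∈ Icc a b → v ∈ Icc a b → IntervalIntegrable f volume u v := by
    intro u v hu hv
    refine hf.mono_set ?_
    rw [uIcc_of_le hab]
    exact uIcc_subset_Icc hu hv
  have haI : a ∈ Icc a b := ⟨le_rfl, hab⟩
  have hbI : b ∈ Icc a b := ⟨hab, le_rfl⟩
  have hcomp : IsCompact (Icc a b ∩ F ⁻¹' Ici 0) :=
    isCompact_Icc.of_isClosed_subset (hFc.preimage_isClosed_of_isClosed isClosed_Icc isClosed_Ici)
      inter_subset_left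
  -- `s` is the last point with `F s ≥ 0`; there `F s = 0`. So `(a, s)` is itself an interval of
  -- zero integral, and on `[s, b]` the previous case applies.
  obtain ⟨s, ⟨hs, hFs⟩, hsmax⟩ := hcomp.exists_isGreatest ⟨a, haI, hFa.ge⟩
  have hFs0 : F s = 0 := by
    refine le_antisymm ?_ hFs
    obtain ⟨t, ht, hFt⟩ := intermediate_value_Icc' hs.2 (hFc.mono (Icc_subset_Icc_left hs.1))
      (show (0 : ℝ) ∈ Icc (F b) (F s) from ⟨h0, hFs⟩)
    have : t ≤ s := hsmax ⟨⟨hs.1.trans ht.1, ht.2⟩, hFt.ge⟩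
    have : t = s := le_antisymm this ht.1
    exact (this ▸ hFt).le
  obtain ⟨G, hGo, hGs, hG1, hG2, hG3⟩ := exists_isOpen_risingSun_of_forall_integral_nonpos hs.2
    (hint hs hbI) (by
      intro y hy
      have hyI : y ∈ Icc a b := ⟨hs.1.trans hy.1, hy.2⟩
      rw [← intervalIntegral.integral_interval_sub_left (hint haI hyI) (hint haI hs)]
      change F y - F s ≤ 0
      rw [hFs0, sub_zero]
      by_contra! hpos
      have : y ≤ s := hsmax ⟨hyI, hpos.le⟩
      have : y = s := le_antisymm this hy.1
      subst this
      exact hpos.ne' hFs0)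
  have hI : IntegrableOn f (Ioo a b) := (intervalIntegrable_iff_integrableOn_Ioo_of_le hab).1 hf
  refine ⟨Ioo a s ∪ G, isOpen_Ioo.union hGo, union_subset (Ioo_subset_Ioo_right hs.2)
    (hGs.trans (Ioo_subset_Ioo_left hs.1)), ?_, ?_, ?_⟩
  · rintro x (hx | hx)
    · exact ⟨a, s, le_rfl, hx.1, hx.2, hs.2, hFs0⟩
    · obtain ⟨z, y, h1, h2⟩ := hG1 x hx
      exact ⟨z, y, hs.1.trans h1, h2⟩
  · have hne : ∀ᵐ x : ℝ, x ≠ s := by simp [ae_iff, measure_singleton]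
    filter_upwards [hG2, hne] with x hx hxs hxI hxG
    rw [mem_union, not_or] at hxG
    refine hx ⟨lt_of_le_of_ne ?_ hxs.symm, hxI.2⟩ hxG.2
    by_contra! hlt
    exact hxG.1 ⟨hxI.1, hlt⟩
  · rw [setIntegral_union _ hGo.measurableSet (hI.mono_set (Ioo_subset_Ioo_right hs.2))
      (hI.mono_set (hGs.trans (Ioo_subset_Ioo_left hs.1))),
      ← integral_Ioc_eq_integral_Ioo, ← intervalIntegral.integral_of_le hs.1]
    · change F s + _ ≤ 0
      linarith
    · rw [Set.disjoint_left]
      intro x hx hxG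
      exact absurd hx.2 (hGs hxG).1.not_gt

/-! ### Level sets of `A₁` weights -/

/-- Level set estimate for a function satisfying the `A₁` condition on an interval. -/
theorem setIntegral_superlevel_le_of_A1 {φ : ℝ → ℝ} {a b c t : ℝ} (hab : a ≤ b)
    (hφ : IntegrableOn φ (Ioo a b))
    (hA : ∀ u v, a ≤ u → u < v → v ≤ b →
      ∀ᵐ x, x ∈ Ioo u v → ∫ y in u..v, φ y ≤ c * (v - u) * φ x)
    (hc : 0 < c) (ht : ∫ x in a..b, φ x ≤ c * t * (b - a)) :
    ∫ x in {x | t ≤ φ x}, φ x ∂(volume.restrict (Ioo a b)) ≤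
      c * t * (volume.restrict (Ioo a b)).real {x | t ≤ φ x} := by
  have hφi : IntervalIntegrable φ volume a b :=
    (intervalIntegrable_iff_integrableOn_Ioo_of_le hab).2 hφ
  have hint : ∀ {u v}, a ≤ u → u ≤ v → v ≤ b → IntervalIntegrable φ volume u v := by
    intro u v hu huv hv
    refine hφi.mono_set ?_
    rw [uIcc_of_le hab]
    exact uIcc_subset_Icc ⟨hu, huv.trans hv⟩ ⟨hu.trans huv, hv⟩
  obtain ⟨G, hGo, hGs, hG1, hG2, hG3⟩ := exists_isOpen_risingSun (f := fun x => φ x - c * t) hab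
    (hφi.sub intervalIntegrable_const) (by
      rw [intervalIntegral.integral_sub hφi intervalIntegrable_const,
        intervalIntegral.integral_const, smul_eq_mul]
      linarith)
  have hGφ : ∀ᵐ x, x ∈ G → t ≤ φ x := by
    rw [ae_iff]
    -- The covering family may be uncountable, so the exceptional null sets are combined by a local
    -- nullity argument.
    refine measure_null_of_locally_null _ fun x hx => ?_
    simp only [mem_ofPred_eq, Classical.not_imp] at hx
    obtain ⟨z, y, haz, hzx, hxy, hyb, h0⟩ := hG1 x hx.1
    refine ⟨_, inter_mem_nhdsWithin _ (Ioo_mem_nhds hzx hxy), ?_⟩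
    have hzy := hzx.trans hxy
    refine measure_mono_null ?_ (ae_iff.1 (hA z y haz hzy hyb))
    rintro w ⟨hw1, hw2⟩
    simp only [mem_ofPred_eq, Classical.not_imp, not_le] at hw1 ⊢
    refine ⟨hw2, ?_⟩
    rw [intervalIntegral.integral_sub (hint haz hzy.le hyb) intervalIntegrable_const,
        intervalIntegral.integral_const, smul_eq_mul] at h0
    have : c * (y - z) * φ w < c * (y - z) * t :=
      mul_lt_mul_of_pos_left hw1.2 (mul_pos hc (sub_pos.2 hzy))
    linarith
  set μ := volume.restrict (Ioo a b) with hμ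
  have hφμ : Integrable φ μ := hφ
  set S : Set ℝ := {x | t ≤ φ x} with hS
  have hSn : NullMeasurableSet S μ := nullMeasurableSet_le aemeasurable_const hφμ.aemeasurable
  have hGφ' : ∀ᵐ x ∂μ, x ∈ G → x ∈ S := ae_restrict_of_ae hGφ
  have hSG : (S ∩ G : Set ℝ) =ᵐ[μ] G := by
    filter_upwards [hGφ'] with x hx
    exact propext ⟨fun h => h.2, fun h => ⟨hx h, h⟩⟩
  have hG2' : ∀ᵐ x ∂μ, x ∉ G → φ x ≤ c * t := by
    rw [ae_restrict_iff' measurableSet_Ioo]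
    filter_upwards [hG2] with x hx h1 h2
    linarith [hx h1 h2]
  -- Split `S` along `G`, which it contains up to a null set: the mean bound handles `G`, the
  -- pointwise bound `φ ≤ c * t` handles the rest.
  rw [← integral_inter_add_sdiff hGo.measurableSet hφμ.integrableOn,
    ← measureReal_inter_add_sdiff (s := S) hGo.measurableSet, mul_add]
  refine add_le_add ?_ ?_
  · rw [setIntegral_congr_set hSG, measureReal_congr hSG]
    have h1 : ∫ x in G, (φ x - c * t) ∂μ ≤ 0 := by
      rwa [hμ, Measure.restrict_restrict hGo.measurableSet, inter_eq_left.2 hGs]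
    rw [integral_sub hφμ.integrableOn (integrable_const _), setIntegral_const, smul_eq_mul] at h1
    linarith
  · have h1 : ∫ x in S \ G, φ x ∂μ ≤ ∫ x in S \ G, c * t ∂μ := by
      refine setIntegral_mono_ae_restrict hφμ.integrableOn (integrable_const _).integrableOn ?_
      rw [EventuallyLE, ae_restrict_iff'₀ (hSn.diff hGo.measurableSet.nullMeasurableSet)]
      filter_upwards [hG2'] with x hx h using hx h.2
    rw [setIntegral_const, smul_eq_mul] at h1
    linarith

/-! ### Layer cake and truncation -/

/-- Layer cake estimate: for a bounded function, level set bounds of `A₁` type give an `Lᵖ` bound. -/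
theorem lintegral_rpow_le_of_superlevel_bound {α : Type*} [MeasurableSpace α] {μ : Measure α}
    [IsFiniteMeasure μ] {g : α → ℝ} {c p l N : ℝ} (hc : 0 ≤ c) (hp : 1 < p)
    (hcp : 0 < c + p - p * c) (hl : 0 ≤ l) (hg : AEMeasurable g μ) (hlg : ∀ᵐ x ∂μ, l ≤ g x)
    (hgN : ∀ x, g x ≤ N) (hgi : Integrable g μ) (hg1 : ∫ x, g x ∂μ ≤ c * l * μ.real univ)
    (hlev : ∀ t, l ≤ t → ∫ x in {x | t ≤ g x}, g x ∂μ ≤ c * t * μ.real {x | t ≤ g x}) :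
    ∫⁻ x, ENNReal.ofReal (g x ^ p) ∂μ ≤
      ENNReal.ofReal (c * l ^ p * μ.real univ / (c + p - p * c)) := by
  have hp0 : 0 < p := by linarith
  have hp1 : 0 < p - 1 := by linarith
  have hg0 : 0 ≤ᵐ[μ] g := hlg.mono fun x hx => hl.trans hx
  set A := ∫⁻ x, ENNReal.ofReal (g x ^ p) ∂μ with hA
  set U := μ.real univ with hU
  have hU0 : 0 ≤ U := measureReal_nonneg
  -- The same quantity `A` is expanded twice: with exponent `p` for `μ`, and with exponent `p - 1`
  -- for `g dμ`.
  set ν := μ.withDensity (fun x => ENNReal.ofReal (g x)) with hν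
  set X := ∫⁻ t in Ioi (0 : ℝ), ν {x | t ≤ g x} * ENNReal.ofReal (t ^ (p - 1 - 1)) with hX
  set Y := ∫⁻ t in Ioi (0 : ℝ), μ {x | t ≤ g x} * ENNReal.ofReal (t ^ (p - 1)) with hY
  have hAY : A = ENNReal.ofReal p * Y := lintegral_rpow_eq_lintegral_meas_le_mul μ hg0 hg hp0
  have hνμ : ν ≪ μ := withDensity_absolutelyContinuous _ _
  have hAX : A = ENNReal.ofReal (p - 1) * X := by
    rw [hX, ← lintegral_rpow_eq_lintegral_meas_le_mul ν (hνμ.ae_le hg0) (hg.mono_ac hνμ) hp1, hν,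
      lintegral_withDensity_eq_lintegral_mul₀ hg.ennreal_ofReal
        ((hg.pow_const _).ennreal_ofReal), hA]
    refine lintegral_congr_ae ?_
    filter_upwards [hg0] with x hx
    have hx : 0 ≤ g x := hx
    rw [Pi.mul_apply, ← ENNReal.ofReal_mul hx]
    congr 1
    rw [← Real.rpow_one_add' hx (by linarith)]
    congr 1; ring
  have hνle : ∀ t, ν {x | t ≤ g x} = ENNReal.ofReal (∫ x in {x | t ≤ g x}, g x ∂μ) := by
    intro t
    rw [hν, withDensity_apply', ofReal_integral_eq_lintegral_ofReal hgi.integrableOn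
      (ae_restrict_of_ae hg0)]
  have hpow : ∀ q : ℝ, 0 < q →
      ∫⁻ t in Ioi (0 : ℝ), (Iic l).indicator (fun t => ENNReal.ofReal (t ^ (q - 1))) t =
        ENNReal.ofReal (l ^ q / q) := by
    intro q hq
    have h1 : IntervalIntegrable (fun t : ℝ => t ^ (q - 1)) volume 0 l :=
      intervalIntegral.intervalIntegrable_rpow' (by linarith)
    rw [setLIntegral_indicator measurableSet_Iic, inter_comm, Ioi_inter_Iic,
      ← ofReal_integral_eq_lintegral_ofReal ((intervalIntegrable_iff_integrableOn_Ioc_of_le hl).1 h1),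
      ← intervalIntegral.integral_of_le hl, integral_rpow (Or.inl (by linarith))]
    · congr 1
      rw [sub_add_cancel, Real.zero_rpow hq.ne', sub_zero]
    · filter_upwards [ae_restrict_mem measurableSet_Ioc] with t ht
      exact Real.rpow_nonneg ht.1.le _
  -- The level bound is only available for `t ≥ l`. Below `l` the level sets have full measure, and
  -- the terms added on each side make the integrands comparable there too, without subtraction in
  -- `[0,∞]`.
  have key : X + ENNReal.ofReal (c * U) * ENNReal.ofReal (l ^ p / p) ≤
      ENNReal.ofReal c * Y + ENNReal.ofReal (c * l * U) * ENNReal.ofReal (l ^ (p - 1) / (p - 1)) := by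
    have hm : ∀ q : ℝ, Measurable ((Iic l).indicator fun t : ℝ => ENNReal.ofReal (t ^ (q - 1))) :=
      fun q => (by fun_prop : Measurable fun t : ℝ => ENNReal.ofReal (t ^ (q - 1))).indicator
        measurableSet_Iic
    rw [← hpow p hp0, ← hpow (p - 1) hp1, hX, hY, ← lintegral_const_mul _ (hm p),
      ← lintegral_const_mul _ (hm (p - 1)), ← lintegral_const_mul' _ _ ENNReal.ofReal_ne_top,
      ← lintegral_add_right _ ((hm p).const_mul _),
      ← lintegral_add_right _ ((hm (p - 1)).const_mul _)]
    refine setLIntegral_mono' measurableSet_Ioi fun t (ht : 0 < t) => ?_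
    have hpt : t ^ (p - 1) = t * t ^ (p - 1 - 1) := by
      rw [← Real.rpow_one_add' ht.le (by linarith)]; congr 1; ring
    have hpn : 0 ≤ t ^ (p - 1) := Real.rpow_nonneg ht.le _
    have hpn' : 0 ≤ t ^ (p - 1 - 1) := Real.rpow_nonneg ht.le _
    by_cases htl : t ≤ l
    · have hfull : ({x | t ≤ g x} : Set α) =ᵐ[μ] univ := by
        filter_upwards [hlg] with x hx
        exact propext ⟨fun _ => trivial, fun _ => htl.trans hx⟩
      rw [indicator_of_mem (show t ∈ Iic l from htl), indicator_of_mem (show t ∈ Iic l from htl),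
        hνle, measure_congr hfull, setIntegral_congr_set hfull, setIntegral_univ, add_comm]
      refine add_le_add (le_of_eq ?_) (by gcongr)
      rw [ENNReal.ofReal_mul hc, hU, ofReal_measureReal, mul_assoc]
    · rw [indicator_of_notMem (show t ∉ Iic l from htl),
        indicator_of_notMem (show t ∉ Iic l from htl), mul_zero, add_zero, mul_zero, add_zero, hνle,
        hpt, ENNReal.ofReal_mul ht.le]
      calc _ ≤ ENNReal.ofReal (c * t * μ.real {x | t ≤ g x}) * ENNReal.ofReal (t ^ (p - 1 - 1)) := by
            gcongr
            exact hlev t (not_le.1 htl).le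
        _ = _ := by
            rw [ENNReal.ofReal_mul (by positivity), ENNReal.ofReal_mul hc, ofReal_measureReal]
            ring
  -- The final inequality has `A` on both sides; boundedness of `g` makes `A` finite and
  -- cancellation legitimate.
  have hAfin : A ≠ ⊤ := by
    refine ne_top_of_le_ne_top (b := ENNReal.ofReal (N ^ p) * μ univ)
      (ENNReal.mul_ne_top ENNReal.ofReal_ne_top (measure_ne_top _ _)) ?_
    rw [← lintegral_const]
    refine lintegral_mono_ae ?_
    filter_upwards [hg0] with x hx
    exact ENNReal.ofReal_le_ofReal (Real.rpow_le_rpow hx (hgN x) hp0.le)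
  have hXfin : X ≠ ⊤ := by
    intro h
    rw [h, ENNReal.mul_top (by simpa using hp)] at hAX
    exact hAfin hAX
  have hYfin : Y ≠ ⊤ := by
    intro h
    rw [h, ENNReal.mul_top (by simpa using hp0)] at hAY
    exact hAfin hAY
  have hl0 : 0 ≤ l ^ p / p := by positivity
  have hl1 : 0 ≤ l ^ (p - 1) / (p - 1) := by positivity
  rw [← ENNReal.ofReal_toReal hXfin, ← ENNReal.ofReal_toReal hYfin,
    ← ENNReal.ofReal_mul (by positivity), ← ENNReal.ofReal_mul (by positivity),
    ← ENNReal.ofReal_mul (by positivity), ← ENNReal.ofReal_add (by positivity) (by positivity),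
    ← ENNReal.ofReal_add (by positivity) (by positivity),
    ENNReal.ofReal_le_ofReal_iff (by positivity)] at key
  rw [← ENNReal.ofReal_toReal hAfin]
  refine ENNReal.ofReal_le_ofReal ?_
  have hAX' := congrArg ENNReal.toReal hAX
  have hAY' := congrArg ENNReal.toReal hAY
  rw [ENNReal.toReal_mul, ENNReal.toReal_ofReal hp1.le] at hAX'
  rw [ENNReal.toReal_mul, ENNReal.toReal_ofReal hp0.le] at hAY'
  have hlp : l ^ p = l * l ^ (p - 1) := by
    rw [← Real.rpow_one_add' hl (by linarith)]; congr 1; ring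
  rw [le_div_iff₀ hcp]
  set x := X.toReal
  set y := Y.toReal
  have key2 : p * (p - 1) * (x + c * U * (l ^ p / p)) ≤
      p * (p - 1) * (c * y + c * l * U * (l ^ (p - 1) / (p - 1))) := by gcongr
  have e1 : p * (p - 1) * (x + c * U * (l ^ p / p)) = p * A.toReal + (p - 1) * (c * U * l ^ p) := by
    rw [hAX']; field_simp
  have e2 : p * (p - 1) * (c * y + c * l * U * (l ^ (p - 1) / (p - 1))) =
      c * (p - 1) * A.toReal + p * (c * U * l ^ p) := by
    rw [hAY', hlp]; field_simp
  rw [e1, e2] at key2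
  linarith

/-- Layer cake estimate: level set bounds of `A₁` type give an `Lᵖ` bound. -/
theorem lintegral_rpow_le_of_setIntegral_superlevel_le {α : Type*} [MeasurableSpace α]
    {μ : Measure α}
    [IsFiniteMeasure μ] {φ : α → ℝ} {c p l : ℝ} (hc : 0 ≤ c) (hp : 1 < p)
    (hcp : 0 < c + p - p * c) (hl : 0 ≤ l) (hlφ : ∀ᵐ x ∂μ, l ≤ φ x)
    (hφ : Integrable φ μ) (hφ1 : ∫ x, φ x ∂μ ≤ c * l * μ.real univ)
    (hlev : ∀ t, l ≤ t → ∫ x in {x | t ≤ φ x}, φ x ∂μ ≤ c * t * μ.real {x | t ≤ φ x}) :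
    ∫⁻ x, ENNReal.ofReal (φ x ^ p) ∂μ ≤
      ENNReal.ofReal (c * l ^ p * μ.real univ / (c + p - p * c)) := by
  have hp0 : 0 < p := by linarith
  have htrunc : ∀ N, l ≤ N → ∫⁻ x, ENNReal.ofReal (min (φ x) N ^ p) ∂μ ≤
      ENNReal.ofReal (c * l ^ p * μ.real univ / (c + p - p * c)) := by
    intro N hN
    have hgi : Integrable (fun x => min (φ x) N) μ := hφ.inf (integrable_const N)
    refine lintegral_rpow_le_of_superlevel_bound hc hp hcp hl
      (hφ.aemeasurable.min aemeasurable_const) (hlφ.mono fun x hx => le_min hx hN)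
      (fun x => min_le_right _ N) hgi
      ((integral_mono hgi hφ fun x => min_le_left _ _).trans hφ1) ?_
    intro t ht
    -- Truncation keeps the level bound: for `t ≤ N` the level set is unchanged and the integrand
    -- decreases, and for `t > N` the set is empty.
    by_cases htN : t ≤ N
    · simp only [le_min_iff, htN, and_true]
      exact (setIntegral_mono hgi.integrableOn hφ.integrableOn fun x => min_le_left _ _).trans
        (hlev t ht)
    · simp [htN]
  have hlim : Tendsto (fun n : ℕ => ∫⁻ x, ENNReal.ofReal (min (φ x) n ^ p) ∂μ) atTop
      (𝓝 (∫⁻ x, ENNReal.ofReal (φ x ^ p) ∂μ)) := by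
    refine lintegral_tendsto_of_tendsto_of_monotone
      (fun n => ((hφ.aemeasurable.min aemeasurable_const).pow_const p).ennreal_ofReal) ?_ ?_
    · filter_upwards [hlφ] with x hx n m hnm
      have hnm' : (n : ℝ) ≤ m := by exact_mod_cast hnm
      exact ENNReal.ofReal_le_ofReal (Real.rpow_le_rpow (le_min (hl.trans hx) n.cast_nonneg)
        (min_le_min_left _ hnm') hp0.le)
    · filter_upwards with x
      refine tendsto_const_nhds.congr' ?_
      filter_upwards [eventually_ge_atTop ⌈φ x⌉₊] with n hn
      rw [min_eq_left ((Nat.le_ceil _).trans (by exact_mod_cast hn))]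
  refine le_of_tendsto hlim ?_
  filter_upwards [eventually_ge_atTop ⌈l⌉₊] with n hn
  exact htrunc n ((Nat.le_ceil _).trans (by exact_mod_cast hn))

/-! ### The reverse Hölder inequality -/

/-- A bounded subinterval is an open interval up to its endpoints. -/
theorem IsSubinterval.exists_Ioo {I J : Set ℝ} (h : IsSubinterval I J) :
    ∃ a b, a < b ∧ Ioo a b ⊆ I ∧ I ⊆ Icc a b := by
  obtain ⟨⟨hc, hnt⟩, hb, -⟩ := h
  obtain ⟨x, hx, y, hy, hxy⟩ := hnt.exists_lt
  have hba := hb.bddAbove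
  have hbb := hb.bddBelow
  have hne : I.Nonempty := ⟨x, hx⟩
  refine ⟨sInf I, sSup I, ((csInf_le hbb hx).trans_lt hxy).trans_le (le_csSup hba hy), ?_,
    subset_Icc_csInf_csSup hbb hba⟩
  rintro z ⟨hz1, hz2⟩
  obtain ⟨u, hu, huz⟩ := exists_lt_of_csInf_lt hne hz1
  obtain ⟨v, hv, hzv⟩ := exists_lt_of_lt_csSup hne hz2
  exact hc.out hu hv ⟨huz.le, hzv.le⟩

theorem Real.volume_restrict_eq_restrict_Ioo {I : Set ℝ} {a b : ℝ} (h1 : Ioo a b ⊆ I)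
    (h2 : I ⊆ Icc a b) : volume.restrict I = volume.restrict (Ioo a b) := by
  refine Measure.restrict_congr_set (EventuallyLE.antisymm ?_ h1.eventuallyLE)
  exact h2.eventuallyLE.trans Ioo_ae_eq_Icc.symm.le

theorem isSubinterval_Ioo {J : Set ℝ} {u v : ℝ} (huv : u < v) (h : Ioo u v ⊆ J) :
    IsSubinterval (Ioo u v) J :=
  ⟨⟨ordConnected_Ioo, (Ioo_infinite huv).nontrivial⟩, Metric.isBounded_Ioo u v, h⟩

/-- Since `φ` is real-valued, its essential infimum is finite, so the `[0,∞]`-valued condition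
already forces integrability and can be turned into a real inequality. -/
theorem IsA1Weight.integrableOn_Ioo_and_ae_le {φ : ℝ → ℝ} {J : Set ℝ} {c u v : ℝ}
    (h : IsA1Weight φ J c) (huv : u < v) (hJ : Ioo u v ⊆ J) :
    IntegrableOn φ (Ioo u v) ∧
      ∀ᵐ x, x ∈ Ioo u v → ∫ y in u..v, φ y ≤ c * (v - u) * φ x := by
  have hc : 0 ≤ c := zero_le_one.trans h.one_le
  have h1 := h.average_le _ (isSubinterval_Ioo huv hJ)
  have hvol : volume (Ioo u v) = ENNReal.ofReal (v - u) := Real.volume_Ioo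
  rw [setLAverage_eq, hvol, ENNReal.div_le_iff (by simpa using huv) ENNReal.ofReal_ne_top] at h1
  set m := essInf (fun x => ENNReal.ofReal (φ x)) (volume.restrict (Ioo u v)) with hm
  have h2 : ∀ᵐ x ∂volume.restrict (Ioo u v), m ≤ ENNReal.ofReal (φ x) := ae_essInf_le
  have hφ0 : ∀ᵐ x ∂volume.restrict (Ioo u v), 0 ≤ φ x := by
    filter_upwards [ae_restrict_mem measurableSet_Ioo] with x hx using h.nonneg x (hJ hx)
  have : NeZero (volume.restrict (Ioo u v)) := ⟨by simp [Measure.restrict_eq_zero, huv]⟩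
  obtain ⟨x₀, hx₀⟩ := h2.exists
  have hmfin : m ≠ ⊤ := ne_top_of_le_ne_top ENNReal.ofReal_ne_top hx₀
  have hint : IntegrableOn φ (Ioo u v) := by
    refine (lintegral_ofReal_ne_top_iff_integrable
      (h.aemeasurable.mono_set hJ).aestronglyMeasurable hφ0).1 ?_
    exact ne_top_of_le_ne_top (ENNReal.mul_ne_top (ENNReal.mul_ne_top ENNReal.ofReal_ne_top hmfin)
      ENNReal.ofReal_ne_top) h1
  refine ⟨hint, ?_⟩
  rw [← ae_restrict_iff' measurableSet_Ioo]
  filter_upwards [h2, hφ0] with x hx hx0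
  rw [← ofReal_integral_eq_lintegral_ofReal hint hφ0] at h1
  have h3 := h1.trans (mul_le_mul_left (mul_le_mul_right hx _) _)
  rw [← ENNReal.ofReal_mul hc, ← ENNReal.ofReal_mul (by positivity),
    ENNReal.ofReal_le_ofReal_iff (mul_nonneg (by positivity) (by linarith))] at h3
  rw [intervalIntegral.integral_of_le huv.le, integral_Ioc_eq_integral_Ioo]
  linarith

theorem IsA1Weight.lintegral_rpow_le {φ : ℝ → ℝ} {J : Set ℝ} {c p a b : ℝ}
    (h : IsA1Weight φ J c) (hp : 1 < p) (hcp : 0 < c + p - p * c) (hab : a < b)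
    (hJ : Ioo a b ⊆ J) :
    ∫⁻ x in Ioo a b, ENNReal.ofReal (φ x ^ p) ≤
      ENNReal.ofReal (1 / (c ^ (p - 1) * (c + p - p * c)) * (⨍ x in Ioo a b, φ x) ^ p * (b - a)) := by
  have hc : 0 < c := zero_lt_one.trans_le h.one_le
  have hba : 0 < b - a := sub_pos.2 hab
  obtain ⟨hint, hae⟩ := h.integrableOn_Ioo_and_ae_le hab hJ
  have hφ0 : ∀ᵐ x ∂volume.restrict (Ioo a b), 0 ≤ φ x := by
    filter_upwards [ae_restrict_mem measurableSet_Ioo] with x hx using h.nonneg x (hJ hx)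
  have hU : (volume.restrict (Ioo a b)).real univ = b - a := by
    simp [hab.le]
  set m := ⨍ x in Ioo a b, φ x with hm
  have hm' : ∫ x in Ioo a b, φ x = m * (b - a) := by
    rw [hm, setAverage_eq, Real.volume_real_Ioo_of_le hab.le, smul_eq_mul]
    field_simp
  have hm'' : ∫ x in a..b, φ x = m * (b - a) := by
    rw [intervalIntegral.integral_of_le hab.le, integral_Ioc_eq_integral_Ioo, hm']
  have hm0 : 0 ≤ m := by
    have : 0 ≤ m * (b - a) := hm' ▸ integral_nonneg_of_ae hφ0
    exact nonneg_of_mul_nonneg_left this hba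
  have hcm : c * (m / c) = m := by field_simp
  have key := lintegral_rpow_le_of_setIntegral_superlevel_le (μ := volume.restrict (Ioo a b))
    (l := m / c) hc.le hp hcp (by positivity) (by
      rw [ae_restrict_iff' measurableSet_Ioo]
      filter_upwards [hae] with x hx hxI
      have := hx hxI
      rw [hm'', mul_right_comm] at this
      rw [div_le_iff₀' hc]
      exact le_of_mul_le_mul_right this hba) hint (by rw [hU, hm', hcm]) (by
      intro t ht
      refine setIntegral_superlevel_le_of_A1 hab.le hint (fun u v hu huv hv =>
        (h.integrableOn_Ioo_and_ae_le huv ((Ioo_subset_Ioo hu hv).trans hJ)).2) hc ?_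
      rw [hm'']
      rw [div_le_iff₀' hc] at ht
      gcongr)
  refine key.trans_eq ?_
  rw [hU, Real.div_rpow hm0 hc.le]
  have hcc : c ^ p = c * c ^ (p - 1) := by
    rw [← Real.rpow_one_add' hc.le (by linarith)]; congr 1; ring
  have : 0 < c ^ (p - 1) := Real.rpow_pos_of_pos hc _
  rw [hcc]
  congr 1
  field_simp

/-- The guard `1 < c` matters: at `c = 1` division by zero gives `c / (c - 1) = 0`, whereas the
intended bound on `p` is infinite. -/
theorem add_sub_mul_pos_of_lt_div {c p : ℝ} (hc : 1 ≤ c) (hpc : 1 < c → p < c / (c - 1)) :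
    0 < c + p - p * c := by
  rcases hc.eq_or_lt with rfl | hc
  · linarith
  · have := hpc hc
    rw [lt_div_iff₀ (by linarith)] at this
    linarith

/-- Sharp reverse Hölder inequality for `A₁` weights. -/
theorem IsA1Weight.memLp_and_average_rpow_le {φ : ℝ → ℝ} {J I : Set ℝ} {c p : ℝ}
    (h : IsA1Weight φ J c) (hp : 1 ≤ p) (hcp : 0 < c + p - p * c) (hI : IsSubinterval I J) :
    MemLp φ (ENNReal.ofReal p) (volume.restrict I) ∧
        ⨍ x in I, φ x ^ p ∂volume ≤
          1 / (c ^ (p - 1) * (c + p - p * c)) * (⨍ x in I, φ x ∂volume) ^ p := by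
  obtain ⟨a, b, hab, h1, h2⟩ := hI.exists_Ioo
  rw [Real.volume_restrict_eq_restrict_Ioo h1 h2]
  have hJ : Ioo a b ⊆ J := h1.trans hI.2.2
  obtain ⟨hint, -⟩ := h.integrableOn_Ioo_and_ae_le hab hJ
  -- At `p = 1` the constant is `1` and equality holds; the layer cake with exponent `p - 1` needs
  -- `p > 1`.
  rcases hp.eq_or_lt with rfl | hp
  · simp only [ENNReal.ofReal_one, sub_self, Real.rpow_zero, Real.rpow_one]
    refine ⟨memLp_one_iff_integrable.2 hint, le_of_eq ?_⟩
    ring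
  have hp0 : 0 < p := by linarith
  have key := h.lintegral_rpow_le hp hcp hab hJ
  have hφ0 : ∀ᵐ x ∂volume.restrict (Ioo a b), 0 ≤ φ x := by
    filter_upwards [ae_restrict_mem measurableSet_Ioo] with x hx using h.nonneg x (hJ hx)
  refine ⟨⟨hint.aestronglyMeasurable, ?_⟩, ?_⟩
  · rw [eLpNorm_lt_top_iff_lintegral_rpow_enorm_lt_top (by simpa using hp0) ENNReal.ofReal_ne_top,
      ENNReal.toReal_ofReal hp0.le]
    refine lt_of_le_of_lt (le_of_eq ?_) (key.trans_lt ENNReal.ofReal_lt_top)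
    refine lintegral_congr_ae ?_
    filter_upwards [hφ0] with x hx
    rw [Real.enorm_eq_ofReal hx, ENNReal.ofReal_rpow_of_nonneg hx hp0.le]
  · have hm0 : 0 ≤ ⨍ x in Ioo a b, φ x := by
      rw [setAverage_eq, smul_eq_mul]
      exact mul_nonneg (by positivity) (integral_nonneg_of_ae hφ0)
    have hc : 0 < c := zero_lt_one.trans_le h.one_le
    have hba : 0 < b - a := sub_pos.2 hab
    rw [setAverage_eq volume (fun x => φ x ^ p), smul_eq_mul, Real.volume_real_Ioo_of_le hab.le,
      inv_mul_le_iff₀ hba, integral_eq_lintegral_of_nonneg_ae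
        (hφ0.mono fun x hx => Real.rpow_nonneg hx p)
        (hint.aemeasurable.pow_const p).aestronglyMeasurable, mul_comm (b - a)]
    exact ENNReal.toReal_le_of_le_ofReal (by positivity) key

/-! ### Power weights and sharpness -/

/-- Away from `a`, integrals of a power of the distance to `a` reduce to integrals of a power over
an interval of the half line. -/
theorem exists_integral_abs_sub_rpow {a u v : ℝ} (huv : u < v) (h : a ≤ u ∨ v ≤ a) :
    ∃ r w, 0 ≤ r ∧ r < w ∧ w - r = v - u ∧ (u = a ∨ v = a → r = 0) ∧
      (∀ x ∈ Ioo u v, r < |x - a| ∧ |x - a| < w) ∧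
      (∀ w' < w, ∃ u' v', u' < v' ∧ Ioo u' v' ⊆ Ioo u v ∧ ∀ x ∈ Ioo u' v', w' < |x - a|) ∧
      ∀ q, -1 < q → IntegrableOn (fun x => |x - a| ^ q) (Ioo u v) ∧
        ∫ x in Ioo u v, |x - a| ^ q = (w ^ (q + 1) - r ^ (q + 1)) / (q + 1) := by
  rcases h with h | h
  · refine ⟨u - a, v - a, by linarith, by linarith, by ring, ?_, ?_, ?_, ?_⟩
    · rintro (h1 | h1) <;> linarith
    · rintro x ⟨hx1, hx2⟩
      rw [abs_of_pos (by linarith)]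
      constructor <;> linarith
    · intro w' hw'
      refine ⟨max u (a + w'), v, max_lt huv (by linarith), Ioo_subset_Ioo_left (le_max_left _ _), ?_⟩
      rintro x ⟨hx1, hx2⟩
      have := max_lt_iff.1 hx1
      rw [abs_of_pos (by linarith)]
      linarith
    · intro q hq
      have hE : EqOn (fun x => (x - a) ^ q) (fun x => |x - a| ^ q) (Ioo u v) := by
        intro x hx
        simp only
        rw [abs_of_pos (by linarith [hx.1])]
      constructor
      · refine IntegrableOn.congr_fun ?_ hE measurableSet_Ioo
        rw [← intervalIntegrable_iff_integrableOn_Ioo_of_le huv.le]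
        have := (intervalIntegral.intervalIntegrable_rpow' (a := u - a) (b := v - a) hq).comp_sub_right a
        simpa using this
      · rw [← setIntegral_congr_fun measurableSet_Ioo hE, ← integral_Ioc_eq_integral_Ioo,
          ← intervalIntegral.integral_of_le huv.le,
          intervalIntegral.integral_comp_sub_right (fun x => x ^ q), integral_rpow (Or.inl hq)]
  · refine ⟨a - v, a - u, by linarith, by linarith, by ring, ?_, ?_, ?_, ?_⟩
    · rintro (h1 | h1) <;> linarith
    · rintro x ⟨hx1, hx2⟩
      rw [abs_of_neg (by linarith)]
      constructor <;> linarith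
    · intro w' hw'
      refine ⟨u, min v (a - w'), lt_min huv (by linarith), Ioo_subset_Ioo_right (min_le_left _ _), ?_⟩
      rintro x ⟨hx1, hx2⟩
      have := lt_min_iff.1 hx2
      rw [abs_of_neg (by linarith)]
      linarith
    · intro q hq
      have hE : EqOn (fun x => (a - x) ^ q) (fun x => |x - a| ^ q) (Ioo u v) := by
        intro x hx
        simp only
        rw [abs_of_neg (by linarith [hx.2]), neg_sub]
      constructor
      · refine IntegrableOn.congr_fun ?_ hE measurableSet_Ioo
        rw [← intervalIntegrable_iff_integrableOn_Ioo_of_le huv.le]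
        have := (intervalIntegral.intervalIntegrable_rpow' (a := a - u) (b := a - v) hq).comp_sub_left a
        simpa using this
      · rw [← setIntegral_congr_fun measurableSet_Ioo hE, ← integral_Ioc_eq_integral_Ioo,
          ← intervalIntegral.integral_of_le huv.le,
          intervalIntegral.integral_comp_sub_left (fun x => x ^ q), integral_rpow (Or.inl hq)]

/-- A proper interval lies on one side of some point, and contains an interval ending there. -/
theorem IsInterval.exists_endpoint {J : Set ℝ} (hJ : IsInterval J) (hne : J ≠ univ) :
    ∃ a, ((∀ x ∈ J, a ≤ x) ∨ ∀ x ∈ J, x ≤ a) ∧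
      ∃ u v, u < v ∧ (u = a ∨ v = a) ∧ Ioo u v ⊆ J := by
  obtain ⟨hc, hnt⟩ := hJ
  obtain ⟨x, hx, y, hy, hxy⟩ := hnt.exists_lt
  obtain ⟨e, he⟩ := (ne_univ_iff_exists_notMem J).1 hne
  have hside : (∀ z ∈ J, e ≤ z) ∨ ∀ z ∈ J, z ≤ e := by
    by_contra! hcon
    obtain ⟨⟨z, hz, hze⟩, z', hz', hez'⟩ := hcon
    exact he (hc.out hz hz' ⟨hze.le, hez'.le⟩)
  rcases hside with h | h
  · have hb : BddBelow J := ⟨e, h⟩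
    refine ⟨sInf J, Or.inl fun z hz => csInf_le hb hz, sInf J, y,
      (csInf_le hb hx).trans_lt hxy, Or.inl rfl, ?_⟩
    rintro z ⟨hz1, hz2⟩
    obtain ⟨t, ht, htz⟩ := exists_lt_of_csInf_lt ⟨x, hx⟩ hz1
    exact hc.out ht hy ⟨htz.le, hz2.le⟩
  · have hb : BddAbove J := ⟨e, h⟩
    refine ⟨sSup J, Or.inr fun z hz => le_csSup hb hz, x, sSup J,
      hxy.trans_le (le_csSup hb hy), Or.inr rfl, ?_⟩
    rintro z ⟨hz1, hz2⟩
    obtain ⟨t, ht, htz⟩ := exists_lt_of_lt_csSup ⟨x, hx⟩ hz2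
    exact hc.out hx ht ⟨hz1.le, htz.le⟩

/-- Because `r ^ s ≥ w ^ s` for `s ≤ 0`. With `s + 1 = 1 / c` this bounds the mean of `x ^ s` over
`(r, w)` by `c` times its infimum `w ^ s`. -/
theorem Real.rpow_add_one_sub_le {s r w : ℝ} (hs : -1 < s) (hs0 : s ≤ 0) (hr : 0 ≤ r) (hrw : r < w) :
    w ^ (s + 1) - r ^ (s + 1) ≤ (w - r) * w ^ s := by
  have hw : 0 < w := hr.trans_lt hrw
  rw [Real.rpow_add_one hw.ne']
  rcases hr.eq_or_lt with rfl | hr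
  · rw [Real.zero_rpow (by linarith)]; linarith
  · rw [Real.rpow_add_one hr.ne']
    have := Real.rpow_le_rpow_of_nonpos hr hrw.le hs0
    nlinarith

/-- The extremal weight: a power of the distance to `a`, made positive at `a`. -/
noncomputable def powerWeight (a s x : ℝ) : ℝ :=
  if x = a then 1 else |x - a| ^ s

/-- The value `1` at `a` is needed because `0 ^ s = 0` for `s ≠ 0`. -/
theorem powerWeight_pos (a s x : ℝ) : 0 < powerWeight a s x := by
  unfold powerWeight
  split_ifs with h
  · exact one_pos
  · exact Real.rpow_pos_of_pos (abs_pos.2 (sub_ne_zero.2 h)) s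

theorem powerWeight_rpow_ae_eq (a s p : ℝ) :
    (fun x => powerWeight a s x ^ p) =ᵐ[volume] fun x => |x - a| ^ (s * p) := by
  have hne : ∀ᵐ x : ℝ, x ≠ a := by simp [ae_iff, measure_singleton]
  filter_upwards [hne] with x hx
  rw [powerWeight, if_neg hx, Real.rpow_mul (abs_nonneg _)]

theorem powerWeight_ae_eq (a s : ℝ) : powerWeight a s =ᵐ[volume] fun x => |x - a| ^ s := by
  simpa using powerWeight_rpow_ae_eq a s 1

theorem measurable_powerWeight (a s : ℝ) : Measurable (powerWeight a s) :=
  Measurable.ite (measurableSet_singleton a) measurable_const (by fun_prop)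

theorem isA1Weight_powerWeight {J : Set ℝ} {a c : ℝ} (hc : 1 ≤ c)
    (ha : (∀ x ∈ J, a ≤ x) ∨ ∀ x ∈ J, x ≤ a) : IsA1Weight (powerWeight a (1 / c - 1)) J c := by
  have hc0 : 0 < c := zero_lt_one.trans_le hc
  refine ⟨hc, fun x _ => (powerWeight_pos _ _ x).le, (measurable_powerWeight _ _).aemeasurable, ?_⟩
  intro I hI
  obtain ⟨u, v, huv, h1, h2⟩ := hI.exists_Ioo
  have hs : -1 < 1 / c - 1 := by linarith [one_div_pos.2 hc0]
  have hs0 : 1 / c - 1 ≤ 0 := by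
    have : 1 / c ≤ 1 := by rw [div_le_one hc0]; exact hc
    linarith
  have hside : a ≤ u ∨ v ≤ a := by
    rcases ha with ha | ha
    · refine Or.inl (le_of_forall_gt_imp_ge_of_dense fun x hx => ?_)
      obtain ⟨z, hz1, hz2⟩ := exists_between (lt_min huv hx)
      exact (ha z (hI.2.2 (h1 ⟨hz1, hz2.trans_le (min_le_left _ _)⟩))).trans
        (hz2.trans_le (min_le_right _ _)).le
    · refine Or.inr (le_of_forall_lt_imp_le_of_dense fun x hx => ?_)
      obtain ⟨z, hz1, hz2⟩ := exists_between (max_lt huv hx)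
      exact ((le_max_right _ _).trans_lt hz1).le.trans
        (ha z (hI.2.2 (h1 ⟨(le_max_left _ _).trans_lt hz1, hz2⟩)))
  obtain ⟨r, w, hr, hrw, hwr, -, hx, -, hq⟩ := exists_integral_abs_sub_rpow huv hside
  rw [Real.volume_restrict_eq_restrict_Ioo h1 h2]
  obtain ⟨hi, hint⟩ := hq _ hs
  have hess : ENNReal.ofReal (w ^ (1 / c - 1)) ≤
      essInf (fun x => ENNReal.ofReal (powerWeight a (1 / c - 1) x)) (volume.restrict (Ioo u v)) := by
    refine le_essInf_of_ae_le _ ?_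
    filter_upwards [ae_restrict_mem measurableSet_Ioo,
      ae_restrict_of_ae (powerWeight_ae_eq a (1 / c - 1))] with x hxI hxe
    rw [hxe]
    exact ENNReal.ofReal_le_ofReal
      (Real.rpow_le_rpow_of_nonpos (hr.trans_lt (hx x hxI).1) (hx x hxI).2.le hs0)
  refine le_trans ?_ (mul_le_mul_right hess _)
  rw [setLAverage_eq, Real.volume_Ioo,
    ENNReal.div_le_iff (by simpa using huv) ENNReal.ofReal_ne_top,
    lintegral_congr_ae (g := fun x => ENNReal.ofReal (|x - a| ^ (1 / c - 1)))
      (ae_restrict_of_ae ((powerWeight_ae_eq a (1 / c - 1)).mono fun x hx => by simp only [hx])),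
    ← ofReal_integral_eq_lintegral_ofReal hi (ae_of_all _ fun x => by positivity), hint,
    ← ENNReal.ofReal_mul hc0.le, ← ENNReal.ofReal_mul (by have := hr.trans_lt hrw; positivity)]
  refine ENNReal.ofReal_le_ofReal ?_
  have := Real.rpow_add_one_sub_le hs hs0 hr hrw
  rw [← hwr, div_le_iff₀ (by linarith)]
  calc _ ≤ _ := this
    _ = _ := by rw [sub_add_cancel]; field_simp

/-- On an interval of length `w` ending at `a` the mean is exactly `c * w ^ (1 / c - 1)`, while near
the far end the weight comes arbitrarily close to `w ^ (1 / c - 1)`; so no smaller constant works.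
-/
theorem hasA1Constant_powerWeight {J : Set ℝ} {a c u v : ℝ} (hc : 1 ≤ c)
    (ha : (∀ x ∈ J, a ≤ x) ∨ ∀ x ∈ J, x ≤ a) (huv : u < v) (hae : u = a ∨ v = a)
    (hJ : Ioo u v ⊆ J) : HasA1Constant (powerWeight a (1 / c - 1)) J c := by
  refine ⟨isA1Weight_powerWeight hc ha, fun C (hC : IsA1Weight _ J C) => ?_⟩
  have hc0 : 0 < c := zero_lt_one.trans_le hc
  have hC0 : 0 < C := zero_lt_one.trans_le hC.one_le
  have hs : -1 < 1 / c - 1 := by linarith [one_div_pos.2 hc0]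
  have hs0 : 1 / c - 1 ≤ 0 := by
    have : 1 / c ≤ 1 := by rw [div_le_one hc0]; exact hc
    linarith
  obtain ⟨r, w, hr, hrw, hwr, hr0, -, hw', hq⟩ :=
    exists_integral_abs_sub_rpow huv (hae.imp (fun h => h.ge) fun h => h.le)
  obtain rfl := hr0 hae
  obtain ⟨-, hC2⟩ := hC.integrableOn_Ioo_and_ae_le huv hJ
  have hint : ∫ y in u..v, powerWeight a (1 / c - 1) y = c * w * w ^ (1 / c - 1) := by
    rw [intervalIntegral.integral_of_le huv.le, integral_Ioc_eq_integral_Ioo,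
      integral_congr_ae (ae_restrict_of_ae (powerWeight_ae_eq a (1 / c - 1))), (hq _ hs).2,
      Real.zero_rpow (by linarith), Real.rpow_add_one hrw.ne', sub_add_cancel]
    field_simp
    ring
  have hle : ∀ w' ∈ Ioo 0 w, c * w ^ (1 / c - 1) ≤ C * w' ^ (1 / c - 1) := by
    intro w' hw
    obtain ⟨u', v', huv', hsub, hgt⟩ := hw' w' hw.2
    have : NeZero (volume.restrict (Ioo u' v')) := ⟨by simp [Measure.restrict_eq_zero, huv']⟩
    obtain ⟨x, hx1, hx2, hx3⟩ := ((ae_restrict_mem (μ := volume) (s := Ioo u' v')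
      measurableSet_Ioo).and (ae_restrict_of_ae (hC2.and (powerWeight_ae_eq a (1 / c - 1))))).exists
    have h1 := hx2 (hsub hx1)
    rw [hint, hx3, ← hwr, sub_zero] at h1
    have h2 : |x - a| ^ (1 / c - 1) ≤ w' ^ (1 / c - 1) :=
      Real.rpow_le_rpow_of_nonpos hw.1 (hgt x hx1).le hs0
    have h3 : w * (c * w ^ (1 / c - 1)) ≤ w * (C * |x - a| ^ (1 / c - 1)) := by linarith
    exact (le_of_mul_le_mul_left h3 hrw).trans (by gcongr)
  have hlim : Tendsto (fun w' : ℝ => C * w' ^ (1 / c - 1)) (𝓝[<] w) (𝓝 (C * w ^ (1 / c - 1))) :=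
    (((Real.continuousAt_rpow_const _ _ (Or.inl hrw.ne')).tendsto).const_mul C).mono_left
      nhdsWithin_le_nhds
  have := ge_of_tendsto hlim (by
    filter_upwards [Ioo_mem_nhdsLT hrw] with w' hw using hle w' hw)
  exact le_of_mul_le_mul_right this (Real.rpow_pos_of_pos hrw _)

/-- The power weight attains equality in the sharp reverse Hölder inequality. -/
theorem average_powerWeight_rpow {a c p u v : ℝ} (hc : 1 ≤ c) (hcp : 0 < c + p - p * c)
    (huv : u < v) (hae : u = a ∨ v = a) :
    0 < ⨍ x in Ioo u v, powerWeight a (1 / c - 1) x ∧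
    ⨍ x in Ioo u v, powerWeight a (1 / c - 1) x ^ p =
      1 / (c ^ (p - 1) * (c + p - p * c)) * (⨍ x in Ioo u v, powerWeight a (1 / c - 1) x) ^ p := by
  have hc0 : 0 < c := zero_lt_one.trans_le hc
  have hs : -1 < 1 / c - 1 := by linarith [one_div_pos.2 hc0]
  -- Integrability of the `p`-th power at `a` is precisely positivity of `c + p - p * c`.
  have hsp1 : (1 / c - 1) * p + 1 = (c + p - p * c) / c := by field_simp; ring
  have hsp0 : 0 < (1 / c - 1) * p + 1 := by rw [hsp1]; positivity
  have hsp : -1 < (1 / c - 1) * p := by linarith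
  obtain ⟨r, w, hr, hrw, hwr, hr0, -, -, hq⟩ :=
    exists_integral_abs_sub_rpow huv (hae.imp (fun h => h.ge) fun h => h.le)
  obtain rfl := hr0 hae
  have h1 : ⨍ x in Ioo u v, powerWeight a (1 / c - 1) x = c * w ^ (1 / c - 1) := by
    rw [setAverage_eq, smul_eq_mul, Real.volume_real_Ioo_of_le huv.le, ← hwr,
      integral_congr_ae (ae_restrict_of_ae (powerWeight_ae_eq a (1 / c - 1))), (hq _ hs).2,
      Real.zero_rpow (by linarith), Real.rpow_add_one hrw.ne', sub_add_cancel, sub_zero, sub_zero]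
    generalize w ^ (1 / c - 1) = y
    field_simp
  have h2 : ⨍ x in Ioo u v, powerWeight a (1 / c - 1) x ^ p =
      c / (c + p - p * c) * w ^ ((1 / c - 1) * p) := by
    rw [setAverage_eq, smul_eq_mul, Real.volume_real_Ioo_of_le huv.le, ← hwr,
      integral_congr_ae (ae_restrict_of_ae (powerWeight_rpow_ae_eq a (1 / c - 1) p)), (hq _ hsp).2,
      Real.zero_rpow hsp0.ne', Real.rpow_add_one hrw.ne', hsp1, sub_zero, sub_zero]
    generalize w ^ ((1 / c - 1) * p) = y
    field_simp
  have hcc : c ^ p = c ^ (p - 1) * c := by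
    rw [← Real.rpow_add_one hc0.ne', sub_add_cancel]
  have : 0 < c ^ (p - 1) := Real.rpow_pos_of_pos hc0 _
  refine ⟨h1 ▸ mul_pos hc0 (Real.rpow_pos_of_pos hrw _), ?_⟩
  rw [h2, h1, Real.mul_rpow hc0.le (Real.rpow_nonneg hrw.le _), ← Real.rpow_mul hrw.le, hcc]
  field_simp

/-! ### Main theorem -/

theorem theorem2 (J : Set ℝ) (hJ : IsInterval J) (c p : ℝ) (hc : 1 ≤ c)
    (hp : 1 ≤ p) (hpc : 1 < c → p < c / (c - 1)) :
    (∀ φ : ℝ → ℝ, IsA1Weight φ J c →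
      (Bornology.IsBounded J → MemLp φ (ENNReal.ofReal p) (volume.restrict J)) ∧
      ∀ I : Set ℝ, IsSubinterval I J →
        MemLp φ (ENNReal.ofReal p) (volume.restrict I) ∧
        ⨍ x in I, φ x ^ p ∂volume ≤
          1 / (c ^ (p - 1) * (c + p - p * c)) * (⨍ x in I, φ x ∂volume) ^ p) ∧
    (J ≠ Set.univ →
      ∀ K : ℝ, K < 1 / (c ^ (p - 1) * (c + p - p * c)) →
        ∃ φ : ℝ → ℝ, (∀ x ∈ J, 0 < φ x) ∧ HasA1Constant φ J c ∧
          ∃ I : Set ℝ, IsSubinterval I J ∧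
            K * (⨍ x in I, φ x ∂volume) ^ p < ⨍ x in I, φ x ^ p ∂volume) := by
  have hcp := add_sub_mul_pos_of_lt_div hc hpc
  refine ⟨fun φ hφ => ⟨fun hb =>
    (hφ.memLp_and_average_rpow_le hp hcp ⟨hJ, hb, subset_rfl⟩).1,
    fun I hI => hφ.memLp_and_average_rpow_le hp hcp hI⟩, fun hne K hK => ?_⟩
  obtain ⟨a, ha, u, v, huv, hae, hsub⟩ := hJ.exists_endpoint hne
  refine ⟨powerWeight a (1 / c - 1), fun x _ => powerWeight_pos _ _ x,
    hasA1Constant_powerWeight hc ha huv hae hsub, Ioo u v, isSubinterval_Ioo huv hsub, ?_⟩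
  obtain ⟨hpos, heq⟩ := average_powerWeight_rpow hc hcp huv hae
  rw [heq]
  exact mul_lt_mul_of_pos_right hK (Real.rpow_pos_of_pos hpos p)
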